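/- For $r\in\mathbb{N}=\{1,2,\dots\}$, an $\mathrm{IP}_r$ set in $\mathbb{N}$ is a set of the form $\bigl\{\sum_{i\in w} n_i : \emptyset\neq w\subseteq\{1,\dots,r\}\bigr\}$ with $n_1,\dots,n_r\in\mathbb{N}$ (not necessarily distinct), and a subset of $\mathbb{N}$ is an $\mathrm{IP}_r^*$ set if it has nonempty intersection with every $\mathrm{IP}_r$ set in $\mathbb{N}$. A map $\vec f\colon\mathbb{Z}\to\mathbb{Z}^d$ is called a polynomial if each of its coordinates is given by a polynomial with rational coefficients (taking integer values on the integers). **Theorem 5.** For any $d$ and any finite partition $\mathbb{Z}^d=\bigcup_{s=1}^{c}C_s$, at least one of the sets $C_s$ has the following property: for any finite set of polynomials $\vec f_i\colon\mathbb{Z}\to\mathbb{Z}^d$, $i=1,\dots,k$, with $\vec f_i(0)=0$ for all $i$, there is an $r_0$ such that for every $r\ge r_0$ the set $$\bigl\{n\in\mathbb{N} : \vec a,\ \vec a+\vec f_1(n),\ \dots,\ \vec a+\vec f_k(n)\in C_s\text{ for some }\vec a\in\mathbb{Z}^d\bigr\}$$ is an $\mathrm{IP}_r^*$ set. -/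

import Mathlib

/-- A map `f : ℤ → ℤ^d` is polynomial if each of its coordinates is given by a polynomial, with
rational coefficients, that takes integer values on the integers. -/
def IsPolynomialMap {d : ℕ} (f : ℤ → Fin d → ℤ) : Prop :=
  ∀ j : Fin d, ∃ p : Polynomial ℚ, ∀ n : ℤ, ((f n j : ℤ) : ℚ) = p.eval (n : ℚ)

/-- An `IP_r` set in the positive integers: the set of all sums of `n_i` over nonempty sets of
indices, for positive integers `n_1, …, n_r` (not necessarily distinct). -/
def IsIPSet (r : ℕ) (S : Set ℕ) : Prop :=
  ∃ n : Fin r → ℕ, (∀ i, 0 < n i) ∧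
    S = {m : ℕ | ∃ w : Finset (Fin r), w.Nonempty ∧ m = ∑ i ∈ w, n i}

/-- An `IP_r^*` set: a set of positive integers that meets every `IP_r` set. -/
def IsIPStarSet (r : ℕ) (A : Set ℕ) : Prop :=
  (∀ n ∈ A, 0 < n) ∧ ∀ S : Set ℕ, IsIPSet r S → (A ∩ S).Nonempty

/-!
Some cell `C s` of a finite partition of an abelian group is piecewise syndetic: the union of
finitely many of its translates contains a translate of every finite set. Colouring the points of
that union by the translate that contains them reduces the theorem to a finitary recurrence
statement (`uniformRecurrence`): for a family of polynomial maps `p i` there is a finite index type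
`ι` such that, for all `n : ι → M`, every finite colouring has a point `a` with the colour of all
`a + p i (∑ t ∈ γ, n t)`, for some nonempty `γ`. Two kinds of uniformity matter. The type `ι` does
not depend on `n`, which gives `IP_r^*` for all `r` that are at least its cardinality. The points `a`
range over a finite set which is chosen before the colouring, so that it can be translated into the thick union
(`IsPiecewiseSyndetic.exists_recurrence`). The cell does not depend on the polynomials, because
piecewise syndeticity of it is all that is used.

The recurrence statement is proved by polynomial exhaustion and colour focusing, as in Walters' proof
of the polynomial van der Waerden theorem. Polynomial maps are defined by vanishing of iterated
differences. A family is measured by the multiset of degrees of its leading classes, where two maps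
of degree `k + 1` are in one class if their difference has degree at most `k`. If `Q` represents a
class of minimal degree, then the maps `x ↦ p i (x + h) - p i h - Q x` lose that class, keep the
degrees of the others, and have new classes of smaller degree only
(`CoveredBy.shiftedDifferences`), so that their multiset of degrees is smaller in the
Dershowitz–Manna order. Recurrence for them lets a focus `b` with points `b + p i h_j` of colour `j`
be moved to `b - Q x`: the points `b - Q x + p i (h_j + x)` still have colour `j`, and the
`b - Q x + p i x` have the colour of the old focus (`exists_recurrence_or_isFocused`). Once there are
more focused colours than colours, a recurrence has been found.
-/

/-! ### Polynomial maps between commutative groups -/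

section PolynomialMaps

variable {M G : Type} [AddCommMonoid M] [AddCommGroup G]

/-- The group of maps `f : M → G` with `f 0 = 0` that are polynomial of degree at most `k`, in the
sense of finite differences: every `x ↦ f (x + h) - f x - f h` has degree at most `k - 1`, and only
the zero map has degree at most `0`. -/
def polyMaps (M G : Type) [AddCommMonoid M] [AddCommGroup G] : ℕ → AddSubgroup (M → G)
  | 0 => ⊥
  | k + 1 =>
    { carrier := {f | f 0 = 0 ∧ ∀ h, (fun x => f (x + h) - f x - f h) ∈ polyMaps M G k}
      zero_mem' := by
        refine ⟨rfl, fun h => ?_⟩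
        convert (polyMaps M G k).zero_mem using 1
        ext x; simp
      add_mem' := by
        rintro f g ⟨hf, hf'⟩ ⟨hg, hg'⟩
        refine ⟨by simp [hf, hg], fun h => ?_⟩
        convert (polyMaps M G k).add_mem (hf' h) (hg' h) using 1
        ext x; simp only [Pi.add_apply]; abel
      neg_mem' := by
        rintro f ⟨hf, hf'⟩
        refine ⟨by simp [hf], fun h => ?_⟩
        convert (polyMaps M G k).neg_mem (hf' h) using 1
        ext x; simp only [Pi.neg_apply]; abel }

theorem mem_polyMaps_zero {f : M → G} : f ∈ polyMaps M G 0 ↔ f = 0 := by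
  simp [polyMaps]

theorem mem_polyMaps_succ {k : ℕ} {f : M → G} :
    f ∈ polyMaps M G (k + 1) ↔
      f 0 = 0 ∧ ∀ h, (fun x => f (x + h) - f x - f h) ∈ polyMaps M G k := by
  rw [polyMaps]; rfl

theorem polyMaps_le_succ (k : ℕ) : polyMaps M G k ≤ polyMaps M G (k + 1) := by
  induction k with
  | zero =>
    intro f hf
    rw [mem_polyMaps_zero] at hf
    exact hf ▸ AddSubgroup.zero_mem _
  | succ k ih =>
    intro f hf
    rw [mem_polyMaps_succ] at hf ⊢
    exact ⟨hf.1, fun h => ih (hf.2 h)⟩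

theorem polyMaps_mono : Monotone (polyMaps M G) :=
  monotone_nat_of_le_succ polyMaps_le_succ

theorem polyMaps_apply_zero {k : ℕ} {f : M → G} (hf : f ∈ polyMaps M G k) : f 0 = 0 :=
  (mem_polyMaps_succ.1 (polyMaps_le_succ k hf)).1

/-- Maps whose coordinates are rational polynomials of degree at most `D` vanishing at `0` belong to
`polyMaps`: the degree-`D` terms of `p (x + h)` and `p x` cancel. -/
theorem mem_polyMaps_of_polynomial {d : ℕ} (D : ℕ) (f : ℤ → Fin d → ℤ) (h0 : f 0 = 0)
    (hf : ∀ j, ∃ p : Polynomial ℚ, p.natDegree ≤ D ∧ ∀ n : ℤ, ((f n j : ℤ) : ℚ) = p.eval (n : ℚ)) :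
    f ∈ polyMaps ℤ (Fin d → ℤ) D := by
  induction D generalizing f with
  | zero =>
    rw [mem_polyMaps_zero]
    ext n j
    obtain ⟨p, hp, hpf⟩ := hf j
    rw [Nat.le_zero] at hp
    have h1 := hpf n
    have h2 := hpf 0
    rw [Polynomial.eq_C_of_natDegree_eq_zero hp] at h1 h2
    simp only [Polynomial.eval_C] at h1 h2
    have h3 : f n j = f 0 j := by exact_mod_cast h1.trans h2.symm
    rw [h3, h0]; rfl
  | succ D ih =>
    rw [mem_polyMaps_succ]
    refine ⟨h0, fun h => ih _ ?_ fun j => ?_⟩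
    · simp [h0]
    · obtain ⟨p, hp, hpf⟩ := hf j
      refine ⟨Polynomial.taylor (h : ℚ) p - p - Polynomial.C (p.eval (h : ℚ)), ?_, fun n => ?_⟩
      · rw [Polynomial.natDegree_sub_C, Polynomial.natDegree_le_iff_coeff_eq_zero]
        intro N hN
        rw [Polynomial.coeff_sub, sub_eq_zero]
        rcases lt_or_ge p.natDegree N with hlt | hge
        · rw [Polynomial.coeff_eq_zero_of_natDegree_lt hlt,
            Polynomial.coeff_eq_zero_of_natDegree_lt (by rwa [Polynomial.natDegree_taylor])]
        · have hN' : N = p.natDegree := by omega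
          rw [hN', Polynomial.coeff_taylor_natDegree, Polynomial.leadingCoeff]
      · simp [Polynomial.taylor_eval, hpf]

end PolynomialMaps

/-! ### Leading classes of a family of polynomial maps -/

section LeadingClasses

variable {M G σ τ : Type} [AddCommMonoid M] [AddCommGroup G]

/-- The family `p` is covered by the leading classes in `L`. A pair `(k, Q)` in `L` stands for the
class of the maps that agree with the polynomial map `Q`, of degree at most `k + 1`, up to a map of
degree at most `k`. Zero maps in the family need no class. -/
def CoveredBy (L : Multiset (ℕ × (M → G))) (p : σ → M → G) : Prop :=
  (∀ z ∈ L, z.2 ∈ polyMaps M G (z.1 + 1)) ∧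
    ∀ i, p i = 0 ∨ ∃ z ∈ L, p i - z.2 ∈ polyMaps M G z.1

/-- Every map of a covered family vanishes at `0`. -/
theorem CoveredBy.apply_zero {L : Multiset (ℕ × (M → G))} {p : σ → M → G} (h : CoveredBy L p)
    (i : σ) : p i 0 = 0 := by
  rcases h.2 i with hi | ⟨z, hz, hi⟩
  · rw [hi]; rfl
  · have h1 := polyMaps_apply_zero hi
    rw [Pi.sub_apply, polyMaps_apply_zero (h.1 z hz), sub_zero] at h1
    exact h1

/-- The degrees of the classes that may replace a removed class of degree `k + 1` when `m` maps of
degree at most `k` appear: each of them forms a class of its own, unless `k = 0` and it is zero. -/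
def lowerDegrees (k m : ℕ) : Multiset ℕ :=
  if k = 0 then 0 else Multiset.replicate m (k - 1)

/-- A family whose members either have degree at most `k` or lie in a class of `L` is covered after
adding to `L` one class for each index. -/
theorem exists_coveredBy [Finite τ] {L : Multiset (ℕ × (M → G))} {k : ℕ} {q : τ → M → G}
    (hL : ∀ z ∈ L, z.2 ∈ polyMaps M G (z.1 + 1))
    (hq : ∀ j, q j ∈ polyMaps M G k ∨ ∃ z ∈ L, q j - z.2 ∈ polyMaps M G z.1) :
    ∃ L', L'.map Prod.fst = L.map Prod.fst + lowerDegrees k (Nat.card τ) ∧ CoveredBy L' q := by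
  classical
  have := Fintype.ofFinite τ
  rcases k with _ | k
  · refine ⟨L, by simp [lowerDegrees], hL, fun j => (hq j).imp_left mem_polyMaps_zero.1⟩
  · let e : τ → ℕ × (M → G) := fun j => (k, if q j ∈ polyMaps M G (k + 1) then q j else 0)
    refine ⟨L + Finset.univ.val.map e, ?_, ?_, fun j => ?_⟩
    · simp [lowerDegrees, e]
    · intro z hz
      rcases Multiset.mem_add.1 hz with hz | hz
      · exact hL z hz
      · obtain ⟨j, -, rfl⟩ := Multiset.mem_map.1 hz
        by_cases hj : q j ∈ polyMaps M G (k + 1)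
        · simp [e, hj]
        · simp [e, hj]
    · right
      rcases hq j with hj | ⟨z, hz, hj⟩
      · refine ⟨e j, Multiset.mem_add.2 (Or.inr (Multiset.mem_map_of_mem _ (by simp))), ?_⟩
        simp [e, hj]
      · exact ⟨z, Multiset.mem_add.2 (Or.inl hz), hj⟩

open Classical in
/-- The shifted differences `x ↦ p i (x + h) - p i h - Q x` of the nonzero members of a family, for
`h` the sum of `n` over a set of indices. -/
noncomputable def shiftedDifferences {ι : Type} (Q : M → G) (p : σ → M → G) (n : ι → M) :
    σ × Finset ι → M → G :=
  fun j => if p j.1 = 0 then 0 else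
    fun x => p j.1 (x + ∑ t ∈ j.2, n t) - p j.1 (∑ t ∈ j.2, n t) - Q x

/-- Passing to shifted differences with respect to a representative `Q` of a class of minimal degree
removes that class, keeps the degrees of the others, and creates only classes of smaller degree. -/
theorem CoveredBy.shiftedDifferences {ι : Type} [Finite σ] [Finite ι]
    {L : Multiset (ℕ × (M → G))} {k : ℕ} {Q : M → G} {p : σ → M → G}
    (h : CoveredBy ((k, Q) ::ₘ L) p) (hmin : ∀ z ∈ L, k ≤ z.1) (n : ι → M) :
    ∃ L', L'.map Prod.fst = L.map Prod.fst + lowerDegrees k (Nat.card (σ × Finset ι)) ∧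
      CoveredBy L' (shiftedDifferences Q p n) := by
  have hQ : Q ∈ polyMaps M G (k + 1) := h.1 (k, Q) (Multiset.mem_cons_self _ _)
  have hL : ∀ z ∈ L, z.2 ∈ polyMaps M G (z.1 + 1) :=
    fun z hz => h.1 z (Multiset.mem_cons_of_mem hz)
  -- `p (x + h) - p h - Q x` is the difference of `p`, plus `p - R`, plus `R - Q`
  have key : ∀ (e : ℕ) (f R : M → G), R ∈ polyMaps M G (e + 1) → f - R ∈ polyMaps M G e →
      ∀ a, ((fun x => f (x + a) - f a - Q x) - (R - Q)) ∈ polyMaps M G e := by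
    intro e f R hR hfR a
    have hf : f ∈ polyMaps M G (e + 1) := by
      have := (polyMaps M G (e + 1)).add_mem (polyMaps_le_succ e hfR) hR
      rwa [sub_add_cancel] at this
    convert (polyMaps M G e).add_mem ((mem_polyMaps_succ.1 hf).2 a) hfR using 1
    ext x; simp only [Pi.sub_apply, Pi.add_apply]; abel
  have main := exists_coveredBy (τ := σ × Finset ι) (L := L.map fun z => (z.1, z.2 - Q)) (k := k)
    (q := _root_.shiftedDifferences Q p n) ?_ ?_
  · simpa [Function.comp_def] using main
  · intro z hz
    obtain ⟨w, hw, rfl⟩ := Multiset.mem_map.1 hz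
    exact (polyMaps M G _).sub_mem (hL w hw)
      (polyMaps_mono (Nat.succ_le_succ (hmin w hw)) hQ)
  · rintro ⟨i, H⟩
    by_cases hi : p i = 0
    · left
      simp only [_root_.shiftedDifferences, hi, if_true]
      exact (polyMaps M G k).zero_mem
    · simp only [_root_.shiftedDifferences, hi, if_false]
      obtain ⟨z, hz, hpz⟩ := (h.2 i).resolve_left hi
      rcases Multiset.mem_cons.1 hz with rfl | hz
      · left
        simpa using key k (p i) Q hQ hpz (∑ t ∈ H, n t)
      · right
        exact ⟨_, Multiset.mem_map_of_mem _ hz, key _ _ _ (hL z hz) hpz _⟩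

end LeadingClasses

/-! ### Colour focusing -/

section ColourFocusing

variable (M G : Type) [AddCommMonoid M] [AddCommGroup G]

/-- The finitary, uniform recurrence property for families of polynomial maps whose leading classes
have the degrees `s`: for a given index type of the family and given colours there are finite types
`ι`, `β` such that for all `n : ι → M` some points `B b`, `b : β`, have the property that in each
colouring one of them, `B b`, has the colour of all `B b + p i (∑ t ∈ γ, n t)`, for some nonempty
`γ`. The type `β` bounds the number of base points independently of the family and of `n`. -/
def UniformRecurrence (s : Multiset ℕ) : Prop :=
  ∀ (σ κ : Type) [Finite σ] [Finite κ], ∃ (ι β : Type) (_ : Finite ι) (_ : Finite β),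
    ∀ (L : Multiset (ℕ × (M → G))) (p : σ → M → G), L.map Prod.fst = s → CoveredBy L p →
      ∀ n : ι → M, ∃ B : β → G, ∀ χ : G → κ, ∃ (b : β) (γ : Finset ι), γ.Nonempty ∧
        ∀ i, χ (B b + p i (∑ t ∈ γ, n t)) = χ (B b)

variable {M G}

/-- The base point `b` is in focus of `r` monochromatic configurations of different colours. -/
def IsFocused {σ κ ι : Type} (r : ℕ) (p : σ → M → G) (n : ι → M) (χ : G → κ) (b : G) : Prop :=
  ∃ (Γ : Fin r → Finset ι) (col : Fin r → κ), (∀ j, (Γ j).Nonempty) ∧ Function.Injective col ∧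
    ∀ i j, p i ≠ 0 → χ (b + p i (∑ t ∈ Γ j, n t)) = col j

/-- The induction on the number `r` of focused colours. A new block of indices, to which uniform
recurrence for the shifted differences applies, moves the focus so that its former colour is the
colour of a further configuration. -/
theorem exists_recurrence_or_isFocused {k : ℕ} {t : Multiset ℕ} (hk : ∀ e ∈ t, k ≤ e)
    (ih : ∀ m, UniformRecurrence M G (t + lowerDegrees k m))
    (σ κ : Type) [Finite σ] [Finite κ] (r : ℕ) :
    ∃ (ι β : Type) (_ : Finite ι) (_ : Finite β),
      ∀ (L : Multiset (ℕ × (M → G))) (p : σ → M → G), L.map Prod.fst = k ::ₘ t → CoveredBy L p →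
        ∀ n : ι → M, ∃ B : β → G, ∀ χ : G → κ, ∃ b : β,
          (∃ γ : Finset ι, γ.Nonempty ∧ ∀ i, χ (B b + p i (∑ t ∈ γ, n t)) = χ (B b)) ∨
            IsFocused r p n χ (B b) := by
  classical
  induction r with
  | zero =>
    refine ⟨Empty, Unit, inferInstance, inferInstance, fun L p _ _ n => ⟨0, fun χ => ⟨(), Or.inr ?_⟩⟩⟩
    exact ⟨Fin.elim0, Fin.elim0, fun j => j.elim0, fun j => j.elim0, fun _ j => j.elim0⟩
  | succ r ihr =>
    obtain ⟨ι₁, β₁, _, _, h₁⟩ := ihr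
    obtain ⟨ι₂, β₂, _, _, h₂⟩ :=
      ih (Nat.card (σ × Finset ι₁)) (σ × Finset ι₁) (β₁ × σ × Finset ι₁ → κ)
    refine ⟨ι₁ ⊕ ι₂, β₂ × β₁ × Finset ι₂, inferInstance, inferInstance, fun L p hL hp n => ?_⟩
    obtain ⟨B₁, hB₁⟩ := h₁ L p hL hp (n ∘ Sum.inl)
    obtain ⟨⟨k', Q⟩, hz, rfl, ht⟩ := (Multiset.map_eq_cons _ _ _ _).2 hL
    simp only at hk ih
    have hmin : ∀ z ∈ L.erase (k', Q), k' ≤ z.1 :=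
      fun z hz => hk _ (ht ▸ Multiset.mem_map_of_mem _ hz)
    have hQ : Q 0 = 0 := polyMaps_apply_zero (hp.1 _ hz)
    obtain ⟨L', hL', hp'⟩ :=
      (show CoveredBy ((k', Q) ::ₘ L.erase (k', Q)) p by
        rwa [Multiset.cons_erase hz]).shiftedDifferences hmin (n ∘ Sum.inl)
    rw [ht] at hL'
    obtain ⟨B₂, hB₂⟩ := h₂ L' _ hL' hp' (n ∘ Sum.inr)
    refine ⟨fun b => B₂ b.1 + B₁ b.2.1 - Q (∑ t ∈ b.2.2, n (Sum.inr t)), fun χ => ?_⟩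
    -- colour a point by the colours of all relevant translates of the first block
    obtain ⟨b₂, γ, hγ, hrec⟩ := hB₂ fun g b =>
      χ (g + B₁ b.1 + p b.2.1 (∑ t ∈ b.2.2, n (Sum.inl t)))
    obtain ⟨b₁, hb₁⟩ := hB₁ fun g => χ (B₂ b₂ + g)
    have hrec' : ∀ i (H : Finset ι₁), p i ≠ 0 →
        χ (B₂ b₂ + B₁ b₁ - Q (∑ t ∈ γ, n (Sum.inr t)) +
          p i (∑ t ∈ H, n (Sum.inl t) + ∑ t ∈ γ, n (Sum.inr t))) =
        χ (B₂ b₂ + B₁ b₁ + p i (∑ t ∈ H, n (Sum.inl t))) := by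
      intro i H hi
      have := congrFun (hrec (i, H)) (b₁, i, H)
      simp only [shiftedDifferences, hi, if_false, Function.comp_apply] at this
      rw [← this, add_comm (∑ t ∈ H, n (Sum.inl t))]
      congr 1
      abel
    -- a recurrence in the first block is one in the sum
    have hmono : (∃ γ₁ : Finset ι₁, γ₁.Nonempty ∧ ∀ i,
        χ (B₂ b₂ + B₁ b₁ + p i (∑ t ∈ γ₁, n (Sum.inl t))) = χ (B₂ b₂ + B₁ b₁)) →
        ∃ b : β₂ × β₁ × Finset ι₂, ∃ γ' : Finset (ι₁ ⊕ ι₂), γ'.Nonempty ∧ ∀ i,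
          χ (B₂ b.1 + B₁ b.2.1 - Q (∑ t ∈ b.2.2, n (Sum.inr t)) + p i (∑ t ∈ γ', n t)) =
          χ (B₂ b.1 + B₁ b.2.1 - Q (∑ t ∈ b.2.2, n (Sum.inr t))) := by
      rintro ⟨γ₁, hγ₁, h⟩
      refine ⟨(b₂, b₁, ∅), γ₁.map Function.Embedding.inl, hγ₁.map, fun i => ?_⟩
      simpa [hQ] using h i
    rcases hb₁ with ⟨γ₁, hγ₁, h⟩ | ⟨Γ, col, hΓ, hcol, hfoc⟩
    · obtain ⟨b, h⟩ := hmono ⟨γ₁, hγ₁, fun i => by simpa [add_assoc] using h i⟩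
      exact ⟨b, Or.inl h⟩
    by_cases hex : ∃ j, col j = χ (B₂ b₂ + B₁ b₁)
    · obtain ⟨j, hj⟩ := hex
      obtain ⟨b, h⟩ := hmono ⟨Γ j, hΓ j, fun i => by
        by_cases hi : p i = 0
        · simp [hi]
        · rw [← hj, ← hfoc i j hi]
          simp [add_assoc]⟩
      exact ⟨b, Or.inl h⟩
    · refine ⟨(b₂, b₁, γ), Or.inr ⟨Fin.cons (γ.map Function.Embedding.inr)
        fun j => (Γ j).disjSum γ, Fin.cons (χ (B₂ b₂ + B₁ b₁)) col, ?_, ?_, ?_⟩⟩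
      · intro j
        refine Fin.cases ?_ (fun j => ?_) j
        · simpa using hγ
        · obtain ⟨x, hx⟩ := hΓ j
          exact ⟨Sum.inl x, by simpa using hx⟩
      · rw [Fin.cons_injective_iff]
        exact ⟨fun ⟨j, hj⟩ => hex ⟨j, hj⟩, hcol⟩
      · intro i j hi
        refine Fin.cases ?_ (fun j => ?_) j
        · simpa [hp.apply_zero i] using hrec' i ∅ hi
        · have h := hrec' i (Γ j) hi
          have h' := hfoc i j hi
          simp only [Function.comp_apply] at h'
          simpa [Finset.sum_disjSum, ← h', add_assoc] using h

/-- One step of the induction: with more focused colours than there are colours, the focus has the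
colour of one of its configurations. -/
theorem uniformRecurrence_cons {k : ℕ} {t : Multiset ℕ} (hk : ∀ e ∈ t, k ≤ e)
    (ih : ∀ m, UniformRecurrence M G (t + lowerDegrees k m)) :
    UniformRecurrence M G (k ::ₘ t) := by
  intro σ κ _ _
  obtain ⟨ι, β, hι, hβ, h⟩ := exists_recurrence_or_isFocused hk ih σ κ (Nat.card κ + 1)
  refine ⟨ι, β, hι, hβ, fun L p hL hp n => ?_⟩
  obtain ⟨B, hB⟩ := h L p hL hp n
  refine ⟨B, fun χ => ?_⟩
  obtain ⟨b, hb | ⟨_, col, -, hcol, -⟩⟩ := hB χ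
  · exact ⟨b, hb⟩
  · have := Nat.card_le_card_of_injective col hcol
    simp at this

/-- Uniform recurrence for all families, by induction along the Dershowitz–Manna order on the
multiset of degrees of the leading classes. -/
theorem uniformRecurrence (s : Multiset ℕ) : UniformRecurrence M G s := by
  refine (Multiset.wellFounded_isDershowitzMannaLT (α := ℕ)).induction s fun s ih => ?_
  rcases Multiset.empty_or_exists_mem s with rfl | ⟨a, ha⟩
  · intro σ κ _ _
    refine ⟨Unit, Unit, inferInstance, inferInstance, fun L p hL hp n =>
      ⟨0, fun χ => ⟨(), Finset.univ, Finset.univ_nonempty, fun i => ?_⟩⟩⟩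
    obtain rfl := Multiset.map_eq_zero.1 hL
    have : p i = 0 := by simpa using hp.2 i
    simp [this]
  · obtain ⟨k, hks, hmin⟩ := s.toFinset.exists_min_image id ⟨a, by simpa using ha⟩
    rw [Multiset.mem_toFinset] at hks
    obtain ⟨t, rfl⟩ := Multiset.exists_cons_of_mem hks
    refine uniformRecurrence_cons (fun e he => hmin e (by simp [he])) fun m => ih _ ?_
    refine ⟨t, lowerDegrees k m, {k}, by simp, rfl, by simp [← Multiset.singleton_add, add_comm], ?_⟩
    intro y hy
    refine ⟨k, by simp, ?_⟩
    unfold lowerDegrees at hy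
    split_ifs at hy with h0
    · simp at hy
    · rw [Multiset.eq_of_mem_replicate hy]
      omega

end ColourFocusing

/-! ### Piecewise syndetic sets -/

section PiecewiseSyndetic

variable {G : Type} [AddCommGroup G]

/-- A set `A` is piecewise syndetic if finitely many translates of `A` have a union that contains a
translate of every finite set. -/
def IsPiecewiseSyndetic (A : Set G) : Prop :=
  ∃ H : Finset G, ∀ F : Finset G, ∃ g, ∀ f ∈ F, ∃ h ∈ H, g + f + h ∈ A

theorem IsPiecewiseSyndetic.of_union {A B : Set G} (h : IsPiecewiseSyndetic (A ∪ B)) :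
    IsPiecewiseSyndetic A ∨ IsPiecewiseSyndetic B := by
  classical
  obtain ⟨H, hH⟩ := h
  rw [or_iff_not_imp_left]
  intro hA
  -- every translate of `E` contains a point at which no shift by `H` leads into `A`
  obtain ⟨E, hE⟩ : ∃ E : Finset G, ∀ g, ∃ e ∈ E, ∀ h ∈ H, g + e + h ∉ A := by
    by_contra! hcon
    exact hA ⟨H, hcon⟩
  refine ⟨Finset.image₂ (· + ·) E H, fun F => ?_⟩
  obtain ⟨g, hg⟩ := hH (Finset.image₂ (· + ·) F E)
  refine ⟨g, fun f hf => ?_⟩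
  obtain ⟨e, he, hne⟩ := hE (g + f)
  obtain ⟨h, hh, hmem⟩ := hg (f + e) (Finset.mem_image₂_of_mem hf he)
  rw [← add_assoc] at hmem
  refine ⟨e + h, Finset.mem_image₂_of_mem he hh, ?_⟩
  rw [← add_assoc]
  exact hmem.resolve_left (hne h hh)

theorem exists_isPiecewiseSyndetic {κ : Type} [Finite κ] {C : κ → Set G}
    (hC : ⋃ s, C s = Set.univ) : ∃ s, IsPiecewiseSyndetic (C s) := by
  classical
  have := Fintype.ofFinite κ
  have key : ∀ J : Finset κ, IsPiecewiseSyndetic (⋃ s ∈ J, C s) →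
      ∃ s, IsPiecewiseSyndetic (C s) := by
    intro J
    induction J using Finset.induction_on with
    | empty =>
      rintro ⟨H, hH⟩
      obtain ⟨g, hg⟩ := hH {0}
      simp at hg
    | insert s J _ ih =>
      intro h
      rw [Finset.set_biUnion_insert] at h
      exact h.of_union.elim (fun h => ⟨s, h⟩) ih
  refine key Finset.univ ⟨{0}, fun F => ⟨0, fun f _ => ⟨0, by simp, ?_⟩⟩⟩
  simp [hC]

/-- Polynomial recurrence in a piecewise syndetic set `A`, along the sums of finitely many elements
whose number does not depend on the elements. A point of the thick union of translates of `A` is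
coloured by a translate to which it belongs. -/
theorem IsPiecewiseSyndetic.exists_recurrence {M σ : Type} [AddCommMonoid M] [Finite σ]
    {A : Set G} (hA : IsPiecewiseSyndetic A) (k : ℕ) :
    ∃ (ι : Type) (_ : Finite ι), ∀ p : σ → M → G, (∀ i, p i ∈ polyMaps M G k) → ∀ n : ι → M,
      ∃ γ : Finset ι, γ.Nonempty ∧ ∃ a ∈ A, ∀ i, a + p i (∑ t ∈ γ, n t) ∈ A := by
  classical
  have := Fintype.ofFinite σ
  obtain ⟨H, hH⟩ := hA
  obtain ⟨ι, β, _, _, h⟩ :=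
    uniformRecurrence (M := M) (G := G) (Multiset.replicate (Fintype.card σ) k) σ (Option H)
  have := Fintype.ofFinite ι
  have := Fintype.ofFinite β
  refine ⟨ι, inferInstance, fun p hp n => ?_⟩
  obtain ⟨B, hB⟩ := h (Finset.univ.val.map fun i => (k, p i)) p
    (by simp)
    ⟨by simpa using fun i => polyMaps_le_succ k (hp i), fun i => Or.inr ⟨(k, p i), by simp, by simp⟩⟩
    n
  obtain ⟨g, hg⟩ := hH (Finset.univ.image B)
  let χ : G → Option H := fun x => if hx : ∃ h : H, g + x + h ∈ A then some hx.choose else none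
  have hχ : ∀ x (h : H), χ x = some h → g + x + h ∈ A := by
    intro x h hx
    by_cases hex : ∃ h : H, g + x + h ∈ A
    · simp only [χ, hex, dif_pos, Option.some.injEq] at hx
      exact hx ▸ hex.choose_spec
    · simp only [χ, hex, dif_neg, not_false_eq_true, reduceCtorEq] at hx
  obtain ⟨b, γ, hγ, hb⟩ := hB χ
  obtain ⟨h, hbh⟩ : ∃ h, χ (B b) = some h := by
    obtain ⟨h, hh, hmem⟩ := hg (B b) (by simp)
    have hex : ∃ h : H, g + B b + h ∈ A := ⟨⟨h, hh⟩, hmem⟩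
    exact ⟨hex.choose, by simp only [χ, hex, dif_pos]⟩
  refine ⟨γ, hγ, g + B b + h, hχ _ _ hbh, fun i => ?_⟩
  have := hχ _ _ ((hb i).trans hbh)
  convert this using 1
  abel

end PiecewiseSyndetic

/-! ### Polynomial configurations in a cell of a partition -/

theorem IsPolynomialMap.exists_mem_polyMaps {d : ℕ} {f : ℤ → Fin d → ℤ} (hf : IsPolynomialMap f)
    (h0 : f 0 = 0) : ∃ D, f ∈ polyMaps ℤ (Fin d → ℤ) D := by
  choose p hp using hf
  exact ⟨Finset.univ.sup fun j => (p j).natDegree, mem_polyMaps_of_polynomial _ f h0 fun j =>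
    ⟨p j, Finset.le_sup (f := fun j => (p j).natDegree) (Finset.mem_univ j), hp j⟩⟩

theorem theorem5 (d : ℕ) (c : ℕ) (C : Fin c → Set (Fin d → ℤ))
    (hdisj : Pairwise fun s t => Disjoint (C s) (C t))
    (hcover : (⋃ s, C s) = Set.univ) :
    ∃ s : Fin c, ∀ (k : ℕ) (f : Fin k → ℤ → Fin d → ℤ),
      (∀ i, IsPolynomialMap (f i)) → (∀ i, f i 0 = 0) →
        ∃ r₀ : ℕ, ∀ r : ℕ, r₀ ≤ r →
          IsIPStarSet r {n : ℕ | 0 < n ∧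
            ∃ a : Fin d → ℤ, a ∈ C s ∧ ∀ i, a + f i (n : ℤ) ∈ C s} := by
  obtain ⟨s, hs⟩ := exists_isPiecewiseSyndetic hcover
  refine ⟨s, fun k f hf h0 => ?_⟩
  choose D hD using fun i => (hf i).exists_mem_polyMaps (h0 i)
  obtain ⟨ι, _, h⟩ := hs.exists_recurrence (M := ℤ) (σ := Fin k) (Finset.univ.sup D)
  have := Fintype.ofFinite ι
  refine ⟨Fintype.card ι, fun r hr => ⟨fun n hn => hn.1, ?_⟩⟩
  rintro S ⟨n, hn, rfl⟩
  obtain ⟨e⟩ : Nonempty (ι ↪ Fin r) :=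
    Function.Embedding.nonempty_of_card_le (by simpa using hr)
  obtain ⟨γ, hγ, a, ha, hrec⟩ := h f
    (fun i => polyMaps_mono (Finset.le_sup (Finset.mem_univ i)) (hD i)) fun t => (n (e t) : ℤ)
  refine ⟨∑ t ∈ γ, n (e t), ⟨Finset.sum_pos (fun t _ => hn _) hγ, a, ha, fun i => ?_⟩,
    γ.map e, hγ.map, by simp⟩
  simpa using hrec i
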